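/- Work in the topological category. Let $K\subset S^3$ be a knot (a locally flat embedded circle), let $X_K=S^3\setminus\nu K$ be its exterior and let $M_K$ be its zero-framed surgery manifold. A slice disc for $K$ is a locally flat, properly embedded disc $D\subset D^4$ with $\partial D=K$; its exterior is $N_D=D^4\setminus\nu D$, where the open tubular neighbourhood $\nu D$ restricts to $\nu K$ on $S^3$, so that $\partial N_D=M_K$. Let $\iota_D\colon\pi_1(M_K)\to\pi_1(N_D)$ be the inclusion induced map. For a group $\Gamma$, the disc $D$ is called $\Gamma$-homotopy ribbon if the inclusion induces a surjection $\pi_1(X_K)\twoheadrightarrow\pi_1(N_D)$ and $\pi_1(N_D)\cong\Gamma$. The lagrangian induced by $D$ is $$P_D:=\ker\bigl(H_1(M_K;\mathbb Z[t^{\pm1}])\to H_1(N_D;\mathbb Z[t^{\pm1}])\bigr),$$ where the coefficients are twisted by the abelianisation maps $\pi_1(M_K)\to H_1(M_K;\mathbb Z)\cong\mathbb Z=\langle t\rangle$ and $\pi_1(N_D)\to H_1(N_D;\mathbb Z)\cong\mathbb Z=\langle t\rangle$, and $\mathbb Z[t^{\pm1}]$ is the group ring of this infinite cyclic group. Two slice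 discs $D_1,D_2$ for $K$ are compatible if there is an isomorphism $f\colon\pi_1(N_{D_1})\to\pi_1(N_{D_2})$ with $f\circ\iota_{D_1}=\iota_{D_2}$. **Proposition.** Let $G:=\mathbb Z\ltimes\mathbb Z[\tfrac12]$, where the generator of $\mathbb Z$ acts on $\mathbb Z[\tfrac12]$ by multiplication by $2$. Let $D_1$ and $D_2$ be $G$-homotopy ribbon discs for a knot $K$. Then $P_{D_1}=P_{D_2}$ if and only if $D_1$ and $D_2$ are compatible. -/

import Mathlib

noncomputable section

namespace HomotopyRibbon

/-! ### First homology with twisted coefficients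

For a pointed space `(Y, y₀)`, a commutative group `A` and a homomorphism `φ : π₁(Y, y₀) → A`,
we define `H₁(Y; ℤ[A])` as the first homology of the complex `ℤ[A] ⊗_{ℤ[π₁(Y)]} C_*(Ỹ)`, where
`C_*(Ỹ)` is the singular chain complex of the universal cover of `Y`. -/

/-- The standard topological `n`-simplex. -/
abbrev Simplex (n : ℕ) : Type := stdSimplex ℝ (Fin (n + 1))

/-- The `i`-th face inclusion of the `n`-simplex in the `(n+1)`-simplex. -/
def faceInclusion {n : ℕ} (i : Fin (n + 2)) : C(Simplex n, Simplex (n + 1)) :=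
  ⟨stdSimplex.map i.succAbove, stdSimplex.continuous_map _⟩

/-- The straight path between two vertices of a simplex. -/
def edge {n : ℕ} (a b : Fin (n + 1)) :
    Path (stdSimplex.vertex a : Simplex n) (stdSimplex.vertex b) where
  toFun t := ⟨AffineMap.lineMap (stdSimplex.vertex a : Simplex n).1
      (stdSimplex.vertex b : Simplex n).1 (t : ℝ),
    (convex_stdSimplex ℝ (Fin (n + 1))).lineMap_mem
      (stdSimplex.vertex a : Simplex n).2 (stdSimplex.vertex b : Simplex n).2 t.2⟩
  continuous_toFun := by
    refine Continuous.subtype_mk ?_ _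
    simp only [AffineMap.lineMap_apply_module]
    fun_prop
  source' := by ext; simp
  target' := by ext; simp

lemma faceInclusion_vertex {n : ℕ} (i : Fin (n + 2)) (a : Fin (n + 1)) :
    faceInclusion i (stdSimplex.vertex a) = stdSimplex.vertex (i.succAbove a) :=
  stdSimplex.map_vertex _ _

/-- A singular `n`-simplex of the universal cover of `(Y, y₀)`: a singular simplex of `Y` together
with a homotopy class of paths from `y₀` to its zeroth vertex. -/
structure LiftedSimplex (Y : Type*) [TopologicalSpace Y] (y₀ : Y) (n : ℕ) where
  simplex : C(Simplex n, Y)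
  lift : Path.Homotopic.Quotient y₀ (simplex (stdSimplex.vertex 0))

namespace LiftedSimplex

variable {Y Z : Type*} [TopologicalSpace Y] [TopologicalSpace Z] {y₀ : Y} {n : ℕ}

lemma trans_cast_right {a b c c' : Y} (p : Path.Homotopic.Quotient a b)
    (q : Path.Homotopic.Quotient b c) (h : c' = c) :
    (p.trans q).cast rfl h = p.trans (q.cast rfl h) := by
  subst h; simp

lemma map_cast_right {a b b' : Y} (f : C(Y, Z)) (p : Path.Homotopic.Quotient a b) (h : b' = b) :
    (p.cast rfl h).map f = (p.map f).cast rfl (congrArg f h) := by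
  subst h; simp

lemma map_trans {a b c : Y} (f : C(Y, Z)) (p : Path.Homotopic.Quotient a b)
    (q : Path.Homotopic.Quotient b c) : (p.trans q).map f = (p.map f).trans (q.map f) := by
  induction p, q using Path.Homotopic.Quotient.ind₂ with | _ p q =>
  rw [← Path.Homotopic.Quotient.mk_trans]
  simp only [← Path.Homotopic.Quotient.mk_map, ← Path.Homotopic.Quotient.mk_trans, Path.map_trans]

/-- The action of a loop class by precomposition, i.e. a deck transformation. -/
def deck (g : FundamentalGroup Y y₀) (s : LiftedSimplex Y y₀ n) : LiftedSimplex Y y₀ n :=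
  ⟨s.simplex, g.toPath.trans s.lift⟩

/-- The `i`-th face; the path to the zeroth vertex is continued along the edge joining the zeroth
vertex of the simplex to the zeroth vertex of the face (a constant path unless `i = 0`). -/
def face (i : Fin (n + 2)) (s : LiftedSimplex Y y₀ (n + 1)) : LiftedSimplex Y y₀ n :=
  ⟨s.simplex.comp (faceInclusion i),
    (s.lift.trans (.map (.mk (edge 0 (i.succAbove 0))) s.simplex)).cast rfl
      (congrArg s.simplex (faceInclusion_vertex i 0))⟩

/-- The image of a lifted simplex under a pointed map. -/
def push (f : C(Y, Z)) (s : LiftedSimplex Y y₀ n) : LiftedSimplex Z (f y₀) n :=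
  ⟨f.comp s.simplex, s.lift.map f⟩

end LiftedSimplex

section Twisted

variable {Y Z : Type*} [TopologicalSpace Y] [TopologicalSpace Z] {y₀ : Y}
variable {A B : Type*} [CommGroup A] [CommGroup B]

open LiftedSimplex

/-- The relations `(g · s) ⊗ 1 = s ⊗ φ(g)` of the tensor product over `ℤ[π₁(Y, y₀)]`. -/
def twistedRelations (φ : FundamentalGroup Y y₀ →* A) (n : ℕ) :
    Submodule (MonoidAlgebra ℤ A) (LiftedSimplex Y y₀ n →₀ MonoidAlgebra ℤ A) :=
  Submodule.span _ (Set.range fun p : FundamentalGroup Y y₀ × LiftedSimplex Y y₀ n =>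
    Finsupp.single (deck p.1 p.2) 1 - Finsupp.single p.2 (MonoidAlgebra.of ℤ A (φ p.1)))

/-- The twisted singular chains `ℤ[A] ⊗_{ℤ[π₁(Y)]} C_n(Ỹ)`. -/
abbrev TwistedChain (φ : FundamentalGroup Y y₀ →* A) (n : ℕ) : Type _ :=
  (LiftedSimplex Y y₀ n →₀ MonoidAlgebra ℤ A) ⧸ twistedRelations φ n

/-- The boundary `∑ (-1)ⁱ dᵢ` on the free module on the simplices of the universal cover. -/
def freeBoundary (Y : Type*) [TopologicalSpace Y] (y₀ : Y) (A : Type*) [CommGroup A] (n : ℕ) :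
    (LiftedSimplex Y y₀ (n + 1) →₀ MonoidAlgebra ℤ A) →ₗ[MonoidAlgebra ℤ A]
      (LiftedSimplex Y y₀ n →₀ MonoidAlgebra ℤ A) :=
  ∑ i : Fin (n + 2), (-1 : ℤ) ^ (i : ℕ) • Finsupp.lmapDomain _ _ (face i)

lemma freeBoundary_single {n : ℕ} (s : LiftedSimplex Y y₀ (n + 1)) (a : MonoidAlgebra ℤ A) :
    freeBoundary Y y₀ A n (Finsupp.single s a) =
      ∑ i : Fin (n + 2), (-1 : ℤ) ^ (i : ℕ) • Finsupp.single (face i s) a := by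
  simp only [freeBoundary, LinearMap.sum_apply, LinearMap.smul_apply, Finsupp.lmapDomain_apply,
    Finsupp.mapDomain_single]

lemma face_deck {n : ℕ} (i : Fin (n + 2)) (g : FundamentalGroup Y y₀)
    (s : LiftedSimplex Y y₀ (n + 1)) : face i (deck g s) = deck g (face i s) := by
  obtain ⟨σ, γ⟩ := s
  simp only [face, deck]
  congr 1
  rw [Path.Homotopic.Quotient.trans_assoc]
  exact trans_cast_right _ _ _

lemma twistedRelations_le_comap (φ : FundamentalGroup Y y₀ →* A) (n : ℕ) :
    twistedRelations φ (n + 1) ≤ (twistedRelations φ n).comap (freeBoundary Y y₀ A n) := by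
  refine Submodule.span_le.2 ?_
  rintro _ ⟨⟨g, s⟩, rfl⟩
  have key : freeBoundary Y y₀ A n
      (Finsupp.single (deck g s) 1 - Finsupp.single s (MonoidAlgebra.of ℤ A (φ g))) =
      ∑ i : Fin (n + 2), (-1 : ℤ) ^ (i : ℕ) • (Finsupp.single (deck g (face i s)) 1 -
        Finsupp.single (face i s) (MonoidAlgebra.of ℤ A (φ g))) := by
    simp only [map_sub, freeBoundary_single, face_deck, Finset.sum_sub_distrib, smul_sub]
  rw [SetLike.mem_coe, Submodule.mem_comap, key]
  refine Submodule.sum_mem _ fun i _ => zsmul_mem (S := Submodule _ _) ?_ _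
  exact Submodule.subset_span (Set.mem_range_self (g, face i s))

/-- The boundary of the twisted singular chain complex. -/
def twistedBoundary (φ : FundamentalGroup Y y₀ →* A) (n : ℕ) :
    TwistedChain φ (n + 1) →ₗ[MonoidAlgebra ℤ A] TwistedChain φ n :=
  Submodule.mapQ _ _ (freeBoundary Y y₀ A n) (twistedRelations_le_comap φ n)

/-- The twisted `1`-cycles. -/
abbrev twistedCycles (φ : FundamentalGroup Y y₀ →* A) :
    Submodule (MonoidAlgebra ℤ A) (TwistedChain φ 1) :=
  LinearMap.ker (twistedBoundary φ 0)

/-- The twisted homology `H₁(Y; ℤ[A])`: cycles modulo boundaries. -/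
abbrev TwistedH1 (φ : FundamentalGroup Y y₀ →* A) : Type _ :=
  twistedCycles φ ⧸ (LinearMap.range (twistedBoundary φ 1)).submoduleOf (twistedCycles φ)

/-- The ring homomorphism of group rings induced by a homomorphism of groups. -/
abbrev groupRingMap (α : A →* B) : MonoidAlgebra ℤ A →+* MonoidAlgebra ℤ B :=
  MonoidAlgebra.mapDomainRingHom ℤ α

/-- The map of free modules induced by a pointed map `f` and a change of coefficients `α`. -/
def freePush (f : C(Y, Z)) (y₀ : Y) (α : A →* B) (n : ℕ) :
    (LiftedSimplex Y y₀ n →₀ MonoidAlgebra ℤ A) →ₛₗ[groupRingMap α]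
      (LiftedSimplex Z (f y₀) n →₀ MonoidAlgebra ℤ B) :=
  Finsupp.lmapDomain (MonoidAlgebra ℤ B) (MonoidAlgebra ℤ B) (push f) ∘ₛₗ
    (Finsupp.mapRange.linearMap (groupRingMap α).toSemilinearMap)

lemma push_deck (f : C(Y, Z)) {n : ℕ} (g : FundamentalGroup Y y₀) (s : LiftedSimplex Y y₀ n) :
    push f (deck g s) = deck (FundamentalGroup.map f y₀ g) (push f s) := by
  simp only [push, deck]
  congr 1
  exact map_trans f _ _

lemma push_face (f : C(Y, Z)) {n : ℕ} (i : Fin (n + 2)) (s : LiftedSimplex Y y₀ (n + 1)) :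
    push f (face i s) = face i (push f s) := by
  simp only [push, face]
  congr 1
  rw [map_cast_right, map_trans, Path.Homotopic.Quotient.map_comp]

lemma freePush_single (f : C(Y, Z)) (α : A →* B) {n : ℕ} (s : LiftedSimplex Y y₀ n)
    (a : MonoidAlgebra ℤ A) :
    freePush f y₀ α n (Finsupp.single s a) = Finsupp.single (push f s) (groupRingMap α a) := by
  simp [freePush]

variable {φ : FundamentalGroup Y y₀ →* A} (f : C(Y, Z)) {ψ : FundamentalGroup Z (f y₀) →* B}
  (α : A →* B)

lemma twistedRelations_le_comap_freePush
    (h : ψ.comp (FundamentalGroup.map f y₀) = α.comp φ) (n : ℕ) :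
    twistedRelations φ n ≤ (twistedRelations ψ n).comap (freePush f y₀ α n) := by
  refine Submodule.span_le.2 ?_
  rintro _ ⟨⟨g, s⟩, rfl⟩
  refine Submodule.subset_span ⟨(FundamentalGroup.map f y₀ g, push f s), ?_⟩
  have hg : ψ (FundamentalGroup.map f y₀ g) = α (φ g) := DFunLike.congr_fun h g
  have hr : groupRingMap α (MonoidAlgebra.of ℤ A (φ g)) =
      MonoidAlgebra.of ℤ B (ψ (FundamentalGroup.map f y₀ g)) := by
    rw [hg]; simp
  simp only [map_sub, freePush_single, push_deck, map_one, hr]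

/-- The chain map induced by a pointed map `f : Y → Z` and a homomorphism `α : A → B` that is
compatible with the coefficient systems `φ` and `ψ`. -/
def twistedChainMap (h : ψ.comp (FundamentalGroup.map f y₀) = α.comp φ) (n : ℕ) :
    TwistedChain φ n →ₛₗ[groupRingMap α] TwistedChain ψ n :=
  Submodule.mapQ _ _ (freePush f y₀ α n) (twistedRelations_le_comap_freePush f α h n)

lemma twistedBoundary_chainMap (h : ψ.comp (FundamentalGroup.map f y₀) = α.comp φ) (n : ℕ)
    (c : TwistedChain φ (n + 1)) :
    twistedBoundary ψ n (twistedChainMap f α h (n + 1) c) =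
      twistedChainMap f α h n (twistedBoundary φ n c) := by
  obtain ⟨c, rfl⟩ := Submodule.Quotient.mk_surjective _ c
  refine congrArg (Submodule.Quotient.mk (p := twistedRelations ψ n)) ?_
  induction c using Finsupp.induction_linear with
  | zero => simp
  | add a b ha hb => simp only [map_add, ha, hb]
  | single s a =>
    simp only [freePush_single, freeBoundary_single, push_face, map_sum, map_zsmul]

/-- The map on first homology with twisted coefficients induced by a pointed map. -/
def twistedH1Map (h : ψ.comp (FundamentalGroup.map f y₀) = α.comp φ) :
    TwistedH1 φ →ₛₗ[groupRingMap α] TwistedH1 ψ :=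
  Submodule.mapQ _ _
    (((twistedChainMap f α h 1).domRestrict (twistedCycles φ)).codRestrict (twistedCycles ψ)
      fun c => by
        simp only [LinearMap.domRestrict_apply, LinearMap.mem_ker, twistedBoundary_chainMap,
          LinearMap.mem_ker.1 c.2, map_zero])
    (by
      rintro c ⟨b, hb⟩
      exact ⟨twistedChainMap f α h 2 b, by
        rw [twistedBoundary_chainMap, hb]; rfl⟩)

end Twisted

section Alexander

variable {Y Z : Type*} [TopologicalSpace Y] [TopologicalSpace Z]

/-- The Alexander module of a pointed space: first homology with coefficients twisted by the
abelianisation `π₁(Y) → H₁(Y; ℤ)`. It is a module over `ℤ[H₁(Y; ℤ)]`, which is the ring `ℤ[t^{±1}]`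
of Laurent polynomials when `H₁(Y; ℤ)` is infinite cyclic with generator `t`. -/
abbrev AlexanderModule (Y : Type*) [TopologicalSpace Y] (y₀ : Y) : Type _ :=
  TwistedH1 (Abelianization.of (G := FundamentalGroup Y y₀))

/-- The map of Alexander modules induced by a pointed map; it is linear over the induced
homomorphism `ℤ[H₁(Y; ℤ)] → ℤ[H₁(Z; ℤ)]`. -/
def alexanderMap (f : C(Y, Z)) (y₀ : Y) :
    AlexanderModule Y y₀ →ₛₗ[groupRingMap (Abelianization.map (FundamentalGroup.map f y₀))]
      AlexanderModule Z (f y₀) :=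
  twistedH1Map f (Abelianization.map (FundamentalGroup.map f y₀)) rfl

end Alexander

/-! ### The Baumslag–Solitar group -/

/-- The action of `ℤ` on the additive group of `ℤ[1/2]`: the generator multiplies by `2`. -/
def doublingAction :
    Multiplicative ℤ →* MulAut (Multiplicative (Localization.Away (2 : ℤ))) :=
  zpowersHom _ (AddEquiv.toMultiplicative (DistribMulAction.toAddEquiv _
    (IsLocalization.Away.algebraMap_isUnit (S := Localization.Away (2 : ℤ)) (2 : ℤ)).unit))

/-- The group `ℤ ⋉ ℤ[1/2]`. -/
abbrev BaumslagSolitar : Type :=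
  Multiplicative (Localization.Away (2 : ℤ)) ⋊[doublingAction] Multiplicative ℤ

/-! ### Knots and slice discs

We work in the topological category. -/

/-- The 3-sphere. -/
abbrev S3 : Type := Metric.sphere (0 : EuclideanSpace ℝ (Fin 4)) 1

/-- The 4-ball. -/
abbrev D4 : Type := Metric.closedBall (0 : EuclideanSpace ℝ (Fin 4)) 1

/-- The 2-disc. -/
abbrev D2 : Type := Metric.closedBall (0 : ℂ) 1

/-- The inclusion of the 3-sphere in the 4-ball as its boundary. -/
def S3.toD4 (x : S3) : D4 := ⟨x, Metric.sphere_subset_closedBall x.2⟩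

/-- The inclusion of the circle in the 2-disc as its boundary. -/
def circleToD2 (z : Circle) : D2 := ⟨z, mem_closedBall_zero_iff.2 z.norm_coe.le⟩

/-- A locally flat embedding of codimension two: an embedding that near every point is the zero
section of an open embedding of a product with the plane. For a disc in the 4-ball this covers
boundary points as well: there the chart is modelled on a half-space. -/
def IsLocallyFlat {S Y : Type*} [TopologicalSpace S] [TopologicalSpace Y] (f : S → Y) : Prop :=
  Topology.IsEmbedding f ∧ ∀ p : S, ∃ V : TopologicalSpace.Opens S, p ∈ V ∧
    ∃ c : V × ℂ → Y, Topology.IsOpenEmbedding c ∧ ∀ x : V, c (x, 0) = f x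

/-- A (locally flat) knot in the 3-sphere. -/
structure Knot where
  toFun : Circle → S3
  locallyFlat : IsLocallyFlat toFun

/-- A (parametrised, trivialised) tubular neighbourhood `S¹ × ℂ → S³` of a knot. The closed
tubular neighbourhood is the image of the product with the unit disc. -/
structure Tube (K : Knot) where
  toFun : Circle × ℂ → S3
  isOpenEmbedding : Topology.IsOpenEmbedding toFun
  core : ∀ z, toFun (z, 0) = K.toFun z

namespace Tube

variable {K : Knot} (κ : Tube K)

/-- The exterior `X_K = S³ ∖ νK`, where `νK` is the open tubular neighbourhood of radius one. -/
abbrev Exterior : Type := {x : S3 // ∀ z : Circle, ∀ w : ℂ, ‖w‖ < 1 → κ.toFun (z, w) ≠ x}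

/-- The parametrisation of the boundary torus of the exterior. -/
def boundary (z w : Circle) : κ.Exterior :=
  ⟨κ.toFun (z, w), fun z' w' hw h => by
    have hw' : w' = w := congrArg Prod.snd (κ.isOpenEmbedding.injective h)
    rw [hw', w.norm_coe] at hw
    exact lt_irrefl _ hw⟩

lemma continuous_boundary : Continuous fun p : Circle × Circle => κ.boundary p.1 p.2 :=
  Continuous.subtype_mk (κ.isOpenEmbedding.continuous.comp
    (continuous_fst.prodMk (continuous_subtype_val.comp continuous_snd))) _

/-- The base point of the exterior, on its boundary torus. -/
def base : κ.Exterior := κ.boundary 1 1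

/-- The longitude of the framing determined by the tubular neighbourhood. -/
def longitude : Path κ.base κ.base where
  toFun t := κ.boundary (Circle.exp (2 * Real.pi * t)) 1
  continuous_toFun := κ.continuous_boundary.comp
    (f := fun t : unitInterval => (Circle.exp (2 * Real.pi * t), (1 : Circle))) (by fun_prop)
  source' := by simp [base]
  target' := by simp [base]

/-- The framing is the zero framing: the longitude is null-homologous in the exterior. -/
def IsZeroFramed : Prop :=
  Abelianization.of (FundamentalGroup.fromPath (.mk κ.longitude)) = 1

/-- The gluing relation of the surgery: the boundary torus `∂D² × S¹` of the solid torus is glued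
to the boundary torus of the exterior. -/
inductive SurgeryRel : κ.Exterior ⊕ (D2 × Circle) → κ.Exterior ⊕ (D2 × Circle) → Prop
  | glue (z w : Circle) : SurgeryRel (.inr (circleToD2 z, w)) (.inl (κ.boundary z w))

/-- The surgery `M_K = X_K ∪ (D² × S¹)` along `K`, in which the longitude determined by the tubular
neighbourhood bounds a disc. It is the zero-framed surgery if the tubular neighbourhood is
zero-framed. -/
abbrev Surgery : Type := Quot κ.SurgeryRel

/-- The base point of the surgery. -/
def surgeryBase : κ.Surgery := Quot.mk _ (.inl κ.base)

end Tube

/-- A slice disc for `K`: a locally flat, properly embedded disc in the 4-ball with boundary `K`. -/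
structure SliceDisc (K : Knot) where
  toFun : D2 → D4
  locallyFlat : IsLocallyFlat toFun
  boundary : ∀ z : Circle, toFun (circleToD2 z) = (K.toFun z).toD4
  interior : ∀ x : D2, ‖(x : ℂ)‖ < 1 → ‖(toFun x : EuclideanSpace ℝ (Fin 4))‖ < 1

/-- A (parametrised, trivialised) tubular neighbourhood `D² × ℂ → D⁴` of a slice disc for `K` that
restricts to the given closed tubular neighbourhood of `K` in the 3-sphere. -/
structure DiscTube {K : Knot} (κ : Tube K) (D : SliceDisc K) where
  toFun : D2 × ℂ → D4
  isOpenEmbedding : Topology.IsOpenEmbedding toFun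
  core : ∀ x, toFun (x, 0) = D.toFun x
  boundary : ∀ z : Circle, ∀ w : ℂ, ‖w‖ ≤ 1 →
    toFun (circleToD2 z, w) = (κ.toFun (z, w)).toD4
  interior : ∀ x : D2, ∀ w : ℂ, ‖(x : ℂ)‖ < 1 →
    ‖(toFun (x, w) : EuclideanSpace ℝ (Fin 4))‖ < 1

namespace DiscTube

variable {K : Knot} {κ : Tube K} {D : SliceDisc K} (δ : DiscTube κ D)

/-- The exterior `N_D = D⁴ ∖ νD`. -/
abbrev Exterior : Type := {y : D4 // ∀ x : D2, ∀ w : ℂ, ‖w‖ < 1 → δ.toFun (x, w) ≠ y}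

/-- The inclusion `X_K → N_D`. -/
def knotInclusion : C(κ.Exterior, δ.Exterior) where
  toFun p := ⟨p.1.toD4, fun x w hw h => by
    have hp : ‖(p.1.toD4 : EuclideanSpace ℝ (Fin 4))‖ = 1 := by
      exact mem_sphere_zero_iff_norm.1 p.1.2
    have hx : ‖(x : ℂ)‖ ≤ 1 := mem_closedBall_zero_iff.1 x.2
    rcases hx.lt_or_eq with hx | hx
    · have := δ.interior x w hx
      rw [h, hp] at this
      exact lt_irrefl _ this
    · have hb := δ.boundary ⟨x, by simpa [Submonoid.unitSphere] using hx⟩ w hw.le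
      have hb' := hb.symm.trans h
      exact p.2 _ w hw (Subtype.ext (congrArg (fun q : D4 => (q : EuclideanSpace ℝ (Fin 4))) hb'))⟩
  continuous_toFun :=
    Continuous.subtype_mk (Continuous.subtype_mk
      (continuous_subtype_val.comp continuous_subtype_val) _) _

/-- The map `D² × S¹ → N_D` parametrising the part of the boundary of `N_D` along the disc. -/
def solidTorusMap : C(D2 × Circle, δ.Exterior) where
  toFun p := ⟨δ.toFun (p.1, p.2), fun x w hw h => by
    have hw' : w = p.2 := congrArg Prod.snd (δ.isOpenEmbedding.injective h)
    rw [hw', p.2.norm_coe] at hw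
    exact lt_irrefl _ hw⟩
  continuous_toFun :=
    Continuous.subtype_mk (δ.isOpenEmbedding.continuous.comp
      (continuous_fst.prodMk (continuous_subtype_val.comp continuous_snd))) _

/-- The inclusion `M_K = ∂N_D → N_D`. -/
def surgeryInclusion : C(κ.Surgery, δ.Exterior) where
  toFun := Quot.lift (Sum.elim δ.knotInclusion δ.solidTorusMap) (by
    rintro _ _ ⟨z, w⟩
    exact Subtype.ext (δ.boundary z w w.norm_coe.le))
  continuous_toFun := by
    refine continuous_quot_lift _ ?_
    exact δ.knotInclusion.continuous.sumElim δ.solidTorusMap.continuous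

/-- The fundamental group of the exterior `N_D`, based at the image of the base point of `M_K`. -/
abbrev Pi1 : Type := FundamentalGroup δ.Exterior (δ.surgeryInclusion κ.surgeryBase)

/-- The inclusion induced map `ι_D : π₁(M_K) → π₁(N_D)`. -/
def pi1Map : FundamentalGroup κ.Surgery κ.surgeryBase →* δ.Pi1 :=
  FundamentalGroup.map δ.surgeryInclusion κ.surgeryBase

/-- The disc is homotopy ribbon: the inclusion induces a surjection `π₁(X_K) → π₁(N_D)`. -/
def IsHomotopyRibbon : Prop :=
  Function.Surjective (FundamentalGroup.map δ.knotInclusion κ.base)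

/-- The disc is `Γ`-homotopy ribbon: it is homotopy ribbon and `π₁(N_D) ≅ Γ`. -/
def IsGroupHomotopyRibbon (Γ : Type*) [Group Γ] : Prop :=
  δ.IsHomotopyRibbon ∧ Nonempty (δ.Pi1 ≃* Γ)

/-- The lagrangian induced by the disc: the kernel of the map of Alexander modules
`H₁(M_K; ℤ[t^{±1}]) → H₁(N_D; ℤ[t^{±1}])`. -/
def lagrangian :
    Submodule (MonoidAlgebra ℤ (Abelianization (FundamentalGroup κ.Surgery κ.surgeryBase)))
      (AlexanderModule κ.Surgery κ.surgeryBase) :=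
  LinearMap.ker (alexanderMap δ.surgeryInclusion κ.surgeryBase)

/-- Two slice discs are compatible if there is an isomorphism `f : π₁(N_{D₁}) → π₁(N_{D₂})` with
`f ∘ ι_{D₁} = ι_{D₂}`. -/
def Compatible {D₁ D₂ : SliceDisc K} (δ₁ : DiscTube κ D₁) (δ₂ : DiscTube κ D₂) : Prop :=
  ∃ f : δ₁.Pi1 ≃* δ₂.Pi1, f.toMonoidHom.comp δ₁.pi1Map = δ₂.pi1Map

end DiscTube

end HomotopyRibbon

end

noncomputable section

namespace HomotopyRibbon

/-! ### Edges of simplices -/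

/-! By a twisted Hurewicz theorem the Alexander module of a space with fundamental group `π` is
`π'/π''`. Surjectivity is `exists_loop_of_mem_twistedCycles` and injectivity is
`mem_commutator_of_chain_mem_range`; both hold for any surjective coefficient system, with its
kernel in place of `π'`. The group `ℤ ⋉ ℤ[1/2]` is metabelian, so for a disc exterior `π''` is
trivial, and a loop in the commutator subgroup of `π₁(M_K)` represents an element of the lagrangian
exactly when `ι_D` kills it. Hence comparing lagrangians amounts to comparing the groups `ker ι_D ∩
π₁(M_K)'` (`lagrangian_le_iff`).

These intersections determine the full kernels, because `ι_D` is onto and the target has trivial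
centre. If `ι₁` kills `x`, it kills every commutator `[y, x]`; equal lagrangians make `ι₂` kill them
too, so `ι₂(x)` is central and therefore trivial (`ker_le_ker_of_commutator`). Two surjections with
the same kernel differ by an isomorphism of their targets, which is compatibility. Conversely,
compatible discs have equal kernels.

Hurewicz is proved on chains. Modulo boundaries, a lifted edge is the difference of the classes of
paths from the base point to its ends (`mk_chain`). Orbit representatives of vertices under the
kernel of the coefficient system then measure the loops left over. -/

lemma edge_apply {n : ℕ} (a b : Fin (n + 1)) (t : unitInterval) (i : Fin (n + 1)) :
    (edge a b t : Simplex n) i =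
      (1 - (t : ℝ)) * (if a = i then 1 else 0) + (t : ℝ) * (if b = i then 1 else 0) := by
  change (AffineMap.lineMap (stdSimplex.vertex a : Simplex n).1
      (stdSimplex.vertex b : Simplex n).1 (t : ℝ)) i = _
  rw [AffineMap.lineMap_apply_module]
  simp [Pi.single_apply, eq_comm]

lemma edge_self {n : ℕ} (a : Fin (n + 1)) :
    (edge a a : Path (stdSimplex.vertex a : Simplex n) (stdSimplex.vertex a)) = Path.refl _ := by
  refine Path.ext (funext fun t => stdSimplex.ext (funext fun i => ?_))
  have h := edge_apply a a t i
  rw [← add_mul, sub_add_cancel, one_mul] at h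
  refine h.trans ?_
  simp [Pi.single_apply, eq_comm]

lemma faceInclusion_edge {n : ℕ} (i : Fin (n + 2)) (a b : Fin (n + 1)) (t : unitInterval) :
    faceInclusion i (edge a b t) = edge (i.succAbove a) (i.succAbove b) t := by
  refine stdSimplex.ext (funext fun j => ?_)
  refine Eq.trans ?_ (edge_apply _ _ t j).symm
  change (FunOnFinite.linearMap ℝ ℝ i.succAbove (edge a b t).1) j = _
  rw [FunOnFinite.linearMap_apply_apply]
  have h : ∀ k, (edge a b t : Simplex n).1 k = _ := fun k => edge_apply a b t k
  simp_rw [h, Finset.sum_add_distrib, ← Finset.mul_sum]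
  congr 2 <;> simp [Finset.sum_ite_eq]

/-- The parameter of a point of the `1`-simplex. -/
def simplexParam (x : Simplex 1) : unitInterval :=
  ⟨x 1, stdSimplex.zero_le x 1, stdSimplex.le_one x 1⟩

lemma continuous_simplexParam : Continuous simplexParam :=
  Continuous.subtype_mk ((continuous_apply 1).comp continuous_subtype_val) _

lemma edge_simplexParam (x : Simplex 1) : edge 0 1 (simplexParam x) = x := by
  refine stdSimplex.ext (funext fun i => (edge_apply _ _ _ i).trans ?_)
  have h := stdSimplex.add_eq_one x
  fin_cases i
  · simp [simplexParam]; linarith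
  · simp [simplexParam]

lemma simplexParam_edge (t : unitInterval) : simplexParam (edge 0 1 t) = t := by
  refine Subtype.ext ((edge_apply _ _ _ 1).trans ?_)
  simp

lemma edge_homotopic {n : ℕ} (a b c : Fin (n + 1)) :
    (Path.Homotopic.Quotient.mk (edge a b : Path (stdSimplex.vertex a : Simplex n) _)).trans
      (.mk (edge b c)) = .mk (edge a c) := by
  have : ContractibleSpace (Simplex n) :=
    (convex_stdSimplex ℝ (Fin (n + 1))).contractibleSpace ⟨_, (stdSimplex.vertex a : Simplex n).2⟩
  exact Subsingleton.elim _ _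

/-! ### Lifted paths and triangles -/

namespace LiftedSimplex

variable {Y Z : Type*} [TopologicalSpace Y] [TopologicalSpace Z] {y₀ : Y}

lemma ext_heq {n : ℕ} {s s' : LiftedSimplex Y y₀ n} (h : s.simplex = s'.simplex)
    (h' : s.lift ≍ s'.lift) : s = s' := by
  cases s; cases s'
  cases h; cases h'
  rfl

lemma trans_heq {a b c b' c' : Y} {p : Path.Homotopic.Quotient a b}
    {q : Path.Homotopic.Quotient b c} {p' : Path.Homotopic.Quotient a b'}
    {q' : Path.Homotopic.Quotient b' c'} (hb : b = b') (hc : c = c') (hp : p ≍ p')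
    (hq : q ≍ q') : p.trans q ≍ p'.trans q' := by
  subst hb hc hp hq; rfl

/-- The lifted `1`-simplex given by a path and a homotopy class of paths from the base point to its
source. -/
def ofPath {a b : Y} (γ : Path.Homotopic.Quotient y₀ a) (P : Path a b) : LiftedSimplex Y y₀ 1 :=
  ⟨⟨fun x => P (simplexParam x), P.continuous.comp continuous_simplexParam⟩,
    γ.cast rfl (by
      change P (simplexParam (stdSimplex.vertex 0)) = a
      rw [← (edge (0 : Fin 2) 1).source, simplexParam_edge, P.source])⟩

lemma eq_ofPath (s : LiftedSimplex Y y₀ 1) {a b : Y} (γ : Path.Homotopic.Quotient y₀ a)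
    (P : Path a b) (hP : ∀ t, s.simplex (edge 0 1 t) = P t) (hγ : s.lift ≍ γ) :
    s = ofPath γ P := by
  refine ext_heq ?_ (hγ.trans (Path.Homotopic.Quotient.cast_heq _ _).symm)
  ext x
  change _ = P _
  rw [← hP, edge_simplexParam]

lemma push_ofPath (f : C(Y, Z)) {a b : Y} (γ : Path.Homotopic.Quotient y₀ a) (P : Path a b) :
    push f (ofPath γ P) = ofPath (γ.map f) (P.map f.continuous) := by
  refine ext_heq rfl ?_
  simp only [push, ofPath]
  rw [map_cast_right]
  exact (Path.Homotopic.Quotient.cast_heq _ _).trans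
    (Path.Homotopic.Quotient.cast_heq _ _).symm

lemma deck_ofPath {a b : Y} (g : FundamentalGroup Y y₀) (γ : Path.Homotopic.Quotient y₀ a)
    (P : Path a b) : deck g (ofPath γ P) = ofPath (g.toPath.trans γ) P := by
  refine ext_heq rfl ?_
  simp only [deck, ofPath]
  rw [trans_cast_right]

/-- Such a face keeps the zeroth vertex, so the path is continued along a constant edge. The
equality is heterogeneous because the endpoints agree only propositionally. -/
lemma lift_face_heq {n : ℕ} (i : Fin (n + 2)) (hi : i.succAbove 0 = 0)
    (s : LiftedSimplex Y y₀ (n + 1)) : (face i s).lift ≍ s.lift := by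
  refine (Path.Homotopic.Quotient.cast_heq _ _).trans ?_
  generalize i.succAbove 0 = b at hi
  subst hi
  rw [edge_self, Path.Homotopic.Quotient.mk_refl]
  exact heq_of_eq (Path.Homotopic.Quotient.trans_refl _)

/-- A triangle in the universal cover with prescribed edges. -/
lemma faces_of_triangle {a b c : Y} (γ : Path.Homotopic.Quotient y₀ a) (P : Path a b)
    (Q : Path b c) (R : Path a c) (τ : C(Simplex 2, Y)) (hP : ∀ t, τ (edge 0 1 t) = P t)
    (hQ : ∀ t, τ (edge 1 2 t) = Q t) (hR : ∀ t, τ (edge 0 2 t) = R t) :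
    ∃ T : LiftedSimplex Y y₀ 2, face 0 T = ofPath (γ.trans (.mk P)) Q ∧
      face 1 T = ofPath γ R ∧ face 2 T = ofPath γ P := by
  have h0 : τ (stdSimplex.vertex 0) = a := by simpa using hP 0
  have h1 : τ (stdSimplex.vertex 1) = b := by simpa using hP 1
  refine ⟨⟨τ, γ.cast rfl h0⟩, eq_ofPath _ _ _ (fun t => ?_) ?_, eq_ofPath _ _ _ (fun t => ?_) ?_,
    eq_ofPath _ _ _ (fun t => ?_) ?_⟩
  · rw [← hQ]
    exact congrArg τ (faceInclusion_edge _ _ _ _)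
  · refine (Path.Homotopic.Quotient.cast_heq _ _).trans
      (trans_heq h0 h1 (Path.Homotopic.Quotient.cast_heq _ _) ?_)
    exact Path.Homotopic.hpath_hext hP
  · rw [← hR]
    exact congrArg τ (faceInclusion_edge _ _ _ _)
  · exact (lift_face_heq 1 rfl _).trans (Path.Homotopic.Quotient.cast_heq _ _)
  · rw [← hP]
    exact congrArg τ (faceInclusion_edge _ _ _ _)
  · exact (lift_face_heq 2 rfl _).trans (Path.Homotopic.Quotient.cast_heq _ _)

end LiftedSimplex

/-! ### Generators of the twisted chain groups -/

section Chains

open LiftedSimplex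

variable {Y Z : Type*} [TopologicalSpace Y] [TopologicalSpace Z] {y₀ : Y}
variable {A B : Type*} [CommGroup A] [CommGroup B]

/-- The twisted chain `1 ⊗ s`. -/
def chain (φ : FundamentalGroup Y y₀ →* A) {n : ℕ} (s : LiftedSimplex Y y₀ n) :
    TwistedChain φ n :=
  Submodule.Quotient.mk (Finsupp.single s 1)

lemma chain_deck (φ : FundamentalGroup Y y₀ →* A) {n : ℕ} (g : FundamentalGroup Y y₀)
    (s : LiftedSimplex Y y₀ n) :
    chain φ (deck g s) = MonoidAlgebra.of ℤ A (φ g) • chain φ s := by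
  rw [chain, chain, ← Submodule.Quotient.mk_smul, Finsupp.smul_single, smul_eq_mul, mul_one]
  exact (Submodule.Quotient.eq _).2 (Submodule.subset_span ⟨(g, s), rfl⟩)

lemma twistedBoundary_chain (φ : FundamentalGroup Y y₀ →* A) {n : ℕ}
    (s : LiftedSimplex Y y₀ (n + 1)) :
    twistedBoundary φ n (chain φ s) =
      ∑ i : Fin (n + 2), (-1 : ℤ) ^ (i : ℕ) • chain φ (face i s) := by
  change Submodule.mkQ _ (freeBoundary Y y₀ A n (Finsupp.single s 1)) = _
  rw [freeBoundary_single, map_sum]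
  simp only [map_zsmul]
  rfl

lemma twistedChainMap_chain (f : C(Y, Z)) {φ : FundamentalGroup Y y₀ →* A}
    {ψ : FundamentalGroup Z (f y₀) →* B} (α : A →* B)
    (h : ψ.comp (FundamentalGroup.map f y₀) = α.comp φ) {n : ℕ} (s : LiftedSimplex Y y₀ n) :
    twistedChainMap f α h n (chain φ s) = chain ψ (push f s) := by
  change Submodule.mkQ _ (freePush f y₀ α n (Finsupp.single s 1)) = _
  rw [freePush_single, map_one]
  rfl

lemma deck_mul {n : ℕ} (g h : FundamentalGroup Y y₀) (s : LiftedSimplex Y y₀ n) :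
    deck (g * h) s = deck h (deck g s) :=
  ext_heq rfl (heq_of_eq (Path.Homotopic.Quotient.trans_assoc _ _ _))

lemma deck_one {n : ℕ} (s : LiftedSimplex Y y₀ n) : deck 1 s = s :=
  ext_heq rfl (heq_of_eq (Path.Homotopic.Quotient.refl_trans _))

/-- Deck transformations act freely: the path to the zeroth vertex can be cancelled. -/
lemma deck_injective {n : ℕ} (s : LiftedSimplex Y y₀ n) :
    Function.Injective fun g : FundamentalGroup Y y₀ => deck g s := by
  intro g h e
  have e' : g.toPath.trans s.lift = h.toPath.trans s.lift := by
    simpa only [deck, LiftedSimplex.mk.injEq, heq_eq_eq, true_and] using e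
  have e'' := congrArg (fun p => Path.Homotopic.Quotient.trans p s.lift.symm) e'
  simpa only [Path.Homotopic.Quotient.trans_assoc, Path.Homotopic.Quotient.trans_symm,
    Path.Homotopic.Quotient.trans_refl] using e''

variable {E : Type*} [AddCommGroup E]

/-- Surjectivity of `φ` lets a group element in a coefficient be absorbed into a deck translate of
the simplex, so the chains `1 ⊗ s` generate additively, without scalars. -/
lemma addSubgroup_eq_top_of_chain {φ : FundamentalGroup Y y₀ →* A}
    (hφ : Function.Surjective φ) {n : ℕ} (S : AddSubgroup (TwistedChain φ n))
    (h : ∀ s, chain φ s ∈ S) : S = ⊤ := by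
  refine (AddSubgroup.eq_top_iff' S).2 fun z => ?_
  obtain ⟨c, rfl⟩ := Submodule.Quotient.mk_surjective _ z
  induction c using Finsupp.induction_linear with
  | zero => exact S.zero_mem
  | add a b ha hb => exact S.add_mem ha hb
  | single s r =>
    have key : ∀ r : MonoidAlgebra ℤ A, r • chain φ s ∈ S := by
      intro r
      induction r using MonoidAlgebra.induction_on with
      | of a =>
        obtain ⟨g, rfl⟩ := hφ a
        rw [← chain_deck]
        exact h _
      | add a b ha hb => rw [add_smul]; exact S.add_mem ha hb
      | smul m a ha => rw [smul_assoc]; exact S.zsmul_mem ha m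
    have := key r
    rwa [chain, ← Submodule.Quotient.mk_smul, Finsupp.smul_single, smul_eq_mul, mul_one] at this

/-- A function on lifted simplices that is invariant under the kernel of the coefficient system
extends to the twisted chains. -/
lemma exists_chain_extension {φ : FundamentalGroup Y y₀ →* A} (hφ : Function.Surjective φ)
    {n : ℕ} (F : LiftedSimplex Y y₀ n → E)
    (hF : ∀ g ∈ φ.ker, ∀ s, F (deck g s) = F s) :
    ∃ Θ : TwistedChain φ n →+ E, ∀ s, Θ (chain φ s) = F s := by
  have hF' : ∀ g h : FundamentalGroup Y y₀, φ g = φ h → ∀ s, F (deck g s) = F (deck h s) := by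
    intro g h e s
    have : g = h * (h⁻¹ * g) := by group
    rw [this, deck_mul]
    exact hF _ (MonoidHom.mem_ker.2 (by rw [map_mul, map_inv, e, inv_mul_cancel])) _
  choose σ hσ using hφ
  -- The section `σ` need not be a homomorphism: by `hF'` the value at `a ⊗ s` does not depend on
  -- the chosen preimage of `a`.
  let Θ₀ : (LiftedSimplex Y y₀ n →₀ MonoidAlgebra ℤ A) →+ E :=
    Finsupp.liftAddHom fun s => (Finsupp.liftAddHom fun a : A =>
      (zmultiplesHom E (F (deck (σ a) s)))).comp MonoidAlgebra.coeffAddEquiv.toAddMonoidHom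
  have hΘ₀ : ∀ s a (m : ℤ), Θ₀ (Finsupp.single s (MonoidAlgebra.single a m)) =
      m • F (deck (σ a) s) := by
    intro s a m
    simp [Θ₀]
  -- `Θ₀` is only additive while the relations form a submodule, so the induction must carry an
  -- arbitrary scalar `r`.
  have hrel : ∀ x ∈ twistedRelations φ n, ∀ r : MonoidAlgebra ℤ A, Θ₀ (r • x) = 0 := by
    intro x hx
    induction hx using Submodule.span_induction with
    | mem x hx =>
      obtain ⟨⟨g, s⟩, rfl⟩ := hx
      intro r
      induction r using MonoidAlgebra.induction_linear with
      | zero => simp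
      | add a b ha hb => rw [add_smul, map_add, ha, hb, add_zero]
      | single a m =>
        rw [smul_sub, Finsupp.smul_single, Finsupp.smul_single, smul_eq_mul, smul_eq_mul, mul_one,
          MonoidAlgebra.of_apply, MonoidAlgebra.single_mul_single, mul_one, map_sub, hΘ₀, hΘ₀,
          ← deck_mul, hF' (g * σ a) (σ (a * φ g)) (by rw [map_mul, hσ, hσ, mul_comm]), sub_self]
    | zero => simp
    | add x y _ _ hx hy => intro r; rw [smul_add, map_add, hx, hy, add_zero]
    | smul a x _ hx => intro r; rw [smul_smul]; exact hx _
  refine ⟨QuotientAddGroup.lift (twistedRelations φ n).toAddSubgroup Θ₀ fun x hx => ?_,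
    fun s => ?_⟩
  · simpa using hrel x hx 1
  · refine (hΘ₀ s 1 1).trans ?_
    rw [one_smul, hF' (σ 1) 1 (by rw [hσ, map_one]), deck_one]

end Chains

/-! ### One-chains modulo boundaries -/

section ChainClasses

open LiftedSimplex Path.Homotopic

variable {Y : Type*} [TopologicalSpace Y] {y₀ : Y} {A : Type*} [CommGroup A]

/-- The twisted `1`-chains modulo boundaries. -/
abbrev ChainClass (φ : FundamentalGroup Y y₀ →* A) : Type _ :=
  TwistedChain φ 1 ⧸ LinearMap.range (twistedBoundary φ 1)

/-- The class modulo boundaries of a lifted path. -/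
def edgeClass (φ : FundamentalGroup Y y₀ →* A) {a b : Y} (γ : Path.Homotopic.Quotient y₀ a)
    (P : Path a b) : ChainClass φ :=
  Submodule.Quotient.mk (chain φ (ofPath γ P))

variable (φ : FundamentalGroup Y y₀ →* A)

/-- The boundary of the lifted triangle is `Q - R + P`. The relations for constant paths,
concatenations and homotopies all come from suitable triangles. -/
lemma edgeClass_of_triangle {a b c : Y} (γ : Path.Homotopic.Quotient y₀ a) (P : Path a b)
    (Q : Path b c) (R : Path a c) (τ : C(Simplex 2, Y)) (hP : ∀ t, τ (edge 0 1 t) = P t)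
    (hQ : ∀ t, τ (edge 1 2 t) = Q t) (hR : ∀ t, τ (edge 0 2 t) = R t) :
    edgeClass φ γ R = edgeClass φ γ P + edgeClass φ (γ.trans (.mk P)) Q := by
  obtain ⟨T, h0, h1, h2⟩ := faces_of_triangle γ P Q R τ hP hQ hR
  have h : (Submodule.Quotient.mk (twistedBoundary φ 1 (chain φ T)) : ChainClass φ) = 0 :=
    (Submodule.Quotient.mk_eq_zero _).2 ⟨_, rfl⟩
  rw [twistedBoundary_chain, Fin.sum_univ_three, h0, h1, h2] at h
  have h' : edgeClass φ (γ.trans (.mk P)) Q - edgeClass φ γ R + edgeClass φ γ P = 0 := by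
    refine Eq.trans ?_ h
    simp [edgeClass, sub_eq_add_neg]
  rw [sub_add_eq_add_sub, sub_eq_zero] at h'
  rw [← h', add_comm]

lemma edgeClass_refl {a : Y} (γ : Path.Homotopic.Quotient y₀ a) :
    edgeClass φ γ (Path.refl a) = 0 := by
  -- The constant triangle gives `c = c + c`.
  have := edgeClass_of_triangle φ γ (Path.refl a) (Path.refl a) (Path.refl a)
    (ContinuousMap.const _ a) (fun _ => rfl) (fun _ => rfl) (fun _ => rfl)
  rw [Quotient.mk_refl, Quotient.trans_refl] at this
  simpa using this

/-- The point of the unit interval nearest to a linear combination of two barycentric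
coordinates. -/
def triangleParam (u v : ℝ) : C(Simplex 2, unitInterval) where
  toFun x := Set.projIcc 0 1 zero_le_one (u * x 1 + v * x 2)
  continuous_toFun := by
    refine continuous_projIcc.comp ?_
    have h : ∀ i, Continuous fun x : Simplex 2 => x i := fun i =>
      (continuous_apply i).comp continuous_subtype_val
    exact ((h 1).const_mul u).add ((h 2).const_mul v)

lemma triangleParam_edge (u v : ℝ) (a b : Fin 3) (t s : unitInterval)
    (h : (1 - (t : ℝ)) * (u * (if a = 1 then 1 else 0) + v * (if a = 2 then 1 else 0)) +
      t * (u * (if b = 1 then 1 else 0) + v * (if b = 2 then 1 else 0)) = s) :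
    triangleParam u v (edge a b t) = s := by
  change Set.projIcc 0 1 zero_le_one (u * (edge a b t : Simplex 2) 1 +
    v * (edge a b t : Simplex 2) 2) = s
  rw [edge_apply, edge_apply, ← Set.projIcc_val (zero_le_one' ℝ) s, ← h]
  congr 1
  ring

lemma edgeClass_trans {a b c : Y} (γ : Path.Homotopic.Quotient y₀ a) (P : Path a b)
    (Q : Path b c) :
    edgeClass φ γ (P.trans Q) = edgeClass φ γ P + edgeClass φ (γ.trans (.mk P)) Q := by
  -- The parameter `x₁ / 2 + x₂` takes the values `0`, `1/2`, `1` at the vertices, so the first two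
  -- edges run through the two halves of `P.trans Q` and the third through all of it.
  refine edgeClass_of_triangle φ γ P Q _ ((P.trans Q : C(unitInterval, Y)).comp
    (triangleParam (1 / 2) 1)) (fun t => ?_) (fun t => ?_) (fun t => ?_)
  · have h : triangleParam (1 / 2) 1 (edge 0 1 t) = ⟨t / 2, by have := t.2.1; positivity,
        by have := t.2.2; linarith⟩ := triangleParam_edge _ _ _ _ _ _ (by simp; ring)
    change (P.trans Q) (triangleParam (1 / 2) 1 (edge 0 1 t)) = _
    rw [h, Path.trans_apply, dif_pos (by have := t.2.2; simp only; linarith)]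
    congr 1
    ext
    simp only
    ring
  · have h : triangleParam (1 / 2) 1 (edge 1 2 t) = ⟨(1 + t) / 2, by have := t.2.1; positivity,
        by have := t.2.2; linarith⟩ := triangleParam_edge _ _ _ _ _ _ (by simp; ring)
    change (P.trans Q) (triangleParam (1 / 2) 1 (edge 1 2 t)) = _
    rw [h, Path.trans_apply]
    split_ifs with ht
    -- The midpoint belongs to the first half in `Path.trans`, so the start of `Q` is a separate
    -- case.
    · have ht0 : t = 0 := Subtype.ext (le_antisymm (by simp only at ht ⊢; simp; linarith) t.2.1)
      subst ht0
      simp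
    · congr 1
      ext
      simp only
      ring
  · have h : triangleParam (1 / 2) 1 (edge 0 2 t) = t :=
      triangleParam_edge _ _ _ _ _ _ (by simp)
    exact congrArg (P.trans Q) h

lemma edgeClass_homotopic {a b : Y} (γ : Path.Homotopic.Quotient y₀ a) {P Q : Path a b}
    (h : P.Homotopic Q) : edgeClass φ γ P = edgeClass φ γ Q := by
  obtain ⟨H⟩ := h
  -- The diagonal cuts the square of the homotopy into two triangles; the vertical sides are
  -- constant, so both `P` and `Q` have the class of `D`.
  let D : Path a b := ⟨⟨fun t => H (t, t), by fun_prop⟩, by simp, by simp⟩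
  have h₁ := edgeClass_of_triangle φ γ P (Path.refl b) D
    (H.toContinuousMap.comp ((triangleParam 0 1).prodMk (triangleParam 1 1)))
    (fun t => ?_) (fun t => ?_) (fun t => ?_)
  have h₂ := edgeClass_of_triangle φ γ (Path.refl a) Q D
    (H.toContinuousMap.comp ((triangleParam 1 1).prodMk (triangleParam 0 1)))
    (fun t => ?_) (fun t => ?_) (fun t => ?_)
  · rw [edgeClass_refl, add_zero] at h₁
    rw [edgeClass_refl, zero_add, Quotient.mk_refl, Quotient.trans_refl] at h₂
    rw [← h₁, h₂]
  all_goals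
    change H (triangleParam _ _ _, triangleParam _ _ _) = _
  · rw [triangleParam_edge _ _ _ _ t t (by simp), triangleParam_edge _ _ _ _ t 0 (by simp)]
    simp
  · rw [triangleParam_edge _ _ _ _ t 1 (by simp), triangleParam_edge _ _ _ _ t t (by simp)]
    simp
  · rw [triangleParam_edge _ _ _ _ t t (by simp), triangleParam_edge _ _ _ _ t t (by simp)]
    rfl
  · rw [triangleParam_edge _ _ _ _ t 0 (by simp), triangleParam_edge _ _ _ _ t t (by simp)]
    simp
  · rw [triangleParam_edge _ _ _ _ t t (by simp), triangleParam_edge _ _ _ _ t 1 (by simp)]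
    simp
  · rw [triangleParam_edge _ _ _ _ t t (by simp), triangleParam_edge _ _ _ _ t t (by simp)]
    rfl

/-- The class modulo boundaries of a homotopy class of paths starting at the base point. -/
def pathClass {a : Y} (γ : Path.Homotopic.Quotient y₀ a) : ChainClass φ :=
  Quotient.lift (fun P => edgeClass φ (.refl y₀) P)
    (fun _ _ h => edgeClass_homotopic φ _ h) γ

lemma pathClass_mk {a : Y} (P : Path y₀ a) : pathClass φ (.mk P) = edgeClass φ (.refl y₀) P :=
  rfl

lemma pathClass_refl : pathClass φ (.refl y₀) = 0 := edgeClass_refl φ _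

lemma pathClass_heq {a b : Y} (h : a = b) {γ : Path.Homotopic.Quotient y₀ a}
    {γ' : Path.Homotopic.Quotient y₀ b} (hγ : γ ≍ γ') : pathClass φ γ = pathClass φ γ' := by
  subst h hγ; rfl

lemma edgeClass_eq {a b : Y} (γ : Path.Homotopic.Quotient y₀ a) (P : Path a b) :
    edgeClass φ γ P = pathClass φ (γ.trans (.mk P)) - pathClass φ γ := by
  induction γ using Path.Homotopic.Quotient.ind with
  | mk γ =>
    rw [← Quotient.mk_trans, pathClass_mk, pathClass_mk, edgeClass_trans, Quotient.refl_trans,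
      add_sub_cancel_left]

/-- The kernel of `φ` acts trivially on twisted chains, so the second path may be lifted from the
base point instead of from the end of `g`. -/
lemma pathClass_trans {g : FundamentalGroup Y y₀} (hg : g ∈ φ.ker) {a : Y}
    (γ : Path.Homotopic.Quotient y₀ a) :
    pathClass φ (g.toPath.trans γ) = pathClass φ g.toPath + pathClass φ γ := by
  induction γ using Path.Homotopic.Quotient.ind with
  | mk P =>
    have h : edgeClass φ g.toPath P = pathClass φ (.mk P) := by
      rw [pathClass_mk, edgeClass, edgeClass, ← Quotient.trans_refl g.toPath, ← deck_ofPath,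
        chain_deck, MonoidHom.mem_ker.1 hg, map_one, one_smul]
    rw [← h, edgeClass_eq, add_sub_cancel]

/-- A lifted edge is its underlying path, and `edgeClass_eq` joins both ends to the base point. Here
`face 0` is the terminal vertex and `face 1` the initial one. -/
lemma mk_chain (s : LiftedSimplex Y y₀ 1) :
    (Submodule.Quotient.mk (chain φ s) : ChainClass φ) =
      pathClass φ (face 0 s).lift - pathClass φ (face 1 s).lift := by
  have hs : s = ofPath s.lift ((edge 0 1).map s.simplex.continuous) :=
    eq_ofPath _ _ _ (fun _ => rfl) HEq.rfl
  refine (congrArg (fun s => (Submodule.Quotient.mk (chain φ s) : ChainClass φ)) hs).trans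
    ((edgeClass_eq φ _ _).trans (congrArg₂ _ ?_ ?_))
  · exact pathClass_heq φ (congrArg s.simplex (faceInclusion_vertex 0 0)).symm
      (Quotient.cast_heq _ _).symm
  · exact pathClass_heq φ (congrArg s.simplex (faceInclusion_vertex 1 0)).symm
      (lift_face_heq 1 rfl s).symm

end ChainClasses

/-! ### The Hurewicz theorem for twisted first homology -/

section Hurewicz

open LiftedSimplex Path.Homotopic

variable {Y : Type*} [TopologicalSpace Y] {y₀ : Y} {A : Type*} [CommGroup A]

lemma pathClass_mul (φ : FundamentalGroup Y y₀ →* A) {g h : FundamentalGroup Y y₀}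
    (hh : h ∈ φ.ker) :
    pathClass φ (g * h).toPath = pathClass φ h.toPath + pathClass φ g.toPath :=
  pathClass_trans φ hh _

/-- The classes of loops in the kernel of the coefficient system. -/
def loopClasses (φ : FundamentalGroup Y y₀ →* A) : AddSubgroup (ChainClass φ) where
  carrier := {x | ∃ g ∈ φ.ker, x = pathClass φ g.toPath}
  zero_mem' := ⟨1, one_mem _, (pathClass_refl φ).symm⟩
  add_mem' := by
    rintro _ _ ⟨g, hg, rfl⟩ ⟨h, hh, rfl⟩
    exact ⟨h * g, mul_mem hh hg, (pathClass_mul φ hg).symm⟩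
  neg_mem' := by
    rintro _ ⟨g, hg, rfl⟩
    refine ⟨g⁻¹, inv_mem hg, ?_⟩
    rw [neg_eq_iff_add_eq_zero, ← pathClass_mul φ hg, inv_mul_cancel]
    exact pathClass_refl φ

variable (φ : FundamentalGroup Y y₀ →* A)

/-- The orbit relation of the kernel of the coefficient system on points of the universal
cover. -/
def deckSetoid : Setoid (LiftedSimplex Y y₀ 0) where
  r v w := ∃ g ∈ φ.ker, deck g v = w
  iseqv :=
    { refl := fun v => ⟨1, one_mem _, deck_one v⟩
      symm := by
        rintro v _ ⟨g, hg, rfl⟩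
        exact ⟨g⁻¹, inv_mem hg, by rw [← deck_mul, mul_inv_cancel, deck_one]⟩
      trans := by
        rintro v _ _ ⟨g, hg, rfl⟩ ⟨h, hh, rfl⟩
        exact ⟨g * h, mul_mem hg hh, deck_mul _ _ _⟩ }

/-- A representative of the orbit of a point of the universal cover. -/
def orbitRep (v : LiftedSimplex Y y₀ 0) : LiftedSimplex Y y₀ 0 :=
  (_root_.Quotient.mk (deckSetoid φ) v).out

lemma orbitRep_deck {g : FundamentalGroup Y y₀} (hg : g ∈ φ.ker) (v : LiftedSimplex Y y₀ 0) :
    orbitRep φ (deck g v) = orbitRep φ v :=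
  congrArg Quotient.out (_root_.Quotient.sound (s := deckSetoid φ) ⟨g, hg, rfl⟩).symm

lemma exists_deck_orbitRep (v : LiftedSimplex Y y₀ 0) :
    ∃ g ∈ φ.ker, deck g (orbitRep φ v) = v :=
  Quotient.mk_out (s := deckSetoid φ) v

/-- The element of the kernel that moves the representative of an orbit to a given point. -/
def orbitDiff (v : LiftedSimplex Y y₀ 0) : φ.ker :=
  ⟨(exists_deck_orbitRep φ v).choose, (exists_deck_orbitRep φ v).choose_spec.1⟩

lemma deck_orbitDiff (v : LiftedSimplex Y y₀ 0) :
    deck (orbitDiff φ v : FundamentalGroup Y y₀) (orbitRep φ v) = v :=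
  (exists_deck_orbitRep φ v).choose_spec.2

/-- Freeness of the action makes the element unique. The factor `g` stands on the right because
`deck` is a right action (`deck_mul`). -/
lemma orbitDiff_deck (g : φ.ker) (v : LiftedSimplex Y y₀ 0) :
    orbitDiff φ (deck (g : FundamentalGroup Y y₀) v) = orbitDiff φ v * g := by
  refine Subtype.ext (deck_injective (orbitRep φ v) ?_)
  have h := deck_orbitDiff φ (deck (g : FundamentalGroup Y y₀) v)
  rw [orbitRep_deck φ g.2] at h
  change deck _ _ = deck ((orbitDiff φ v : FundamentalGroup Y y₀) * (g : FundamentalGroup Y y₀)) _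
  rw [h, deck_mul, deck_orbitDiff]

variable {φ}

/-- Surjectivity in the Hurewicz theorem: every cycle is homologous to a loop in the kernel of the
coefficient system. -/
theorem exists_loop_of_mem_twistedCycles (hφ : Function.Surjective φ) {z : TwistedChain φ 1}
    (hz : z ∈ twistedCycles φ) :
    ∃ P : Path y₀ y₀, FundamentalGroup.fromPath (.mk P) ∈ φ.ker ∧
      z - chain φ (ofPath (.refl y₀) P) ∈ LinearMap.range (twistedBoundary φ 1) := by
  -- The path class of a vertex is not invariant under the kernel of `φ`, but that of its orbit
  -- representative is; by `hcone` the two differ by a loop class.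
  obtain ⟨Q, hQ⟩ := exists_chain_extension hφ (fun v => pathClass φ (orbitRep φ v).lift)
    (fun g hg v => by rw [orbitRep_deck φ hg])
  have hcone : ∀ v : LiftedSimplex Y y₀ 0,
      pathClass φ v.lift - Q (chain φ v) ∈ loopClasses φ := by
    intro v
    refine ⟨_, (orbitDiff φ v).2, ?_⟩
    have h := congrArg (fun v : LiftedSimplex Y y₀ 0 => pathClass φ v.lift) (deck_orbitDiff φ v)
    have h' : pathClass φ (deck (orbitDiff φ v : FundamentalGroup Y y₀) (orbitRep φ v)).lift =
      _ := pathClass_trans φ (orbitDiff φ v).2 (orbitRep φ v).lift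
    rw [hQ, ← h, h', add_sub_cancel_right]
  -- For every chain `c`, the class of `c` minus `Q (∂c)` is a loop class; for a cycle the
  -- correction vanishes.
  have htop := addSubgroup_eq_top_of_chain hφ ((loopClasses φ).comap
    ((Submodule.mkQ (LinearMap.range (twistedBoundary φ 1))).toAddMonoidHom -
      Q.comp (twistedBoundary φ 0).toAddMonoidHom)) (fun s => by
    change (Submodule.Quotient.mk (chain φ s) : ChainClass φ) -
      Q (twistedBoundary φ 0 (chain φ s)) ∈ loopClasses φ
    rw [mk_chain, twistedBoundary_chain, Fin.sum_univ_two]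
    have h := sub_mem (hcone (face 0 s)) (hcone (face 1 s))
    convert! h using 1
    simp
    abel)
  have hz' : (Submodule.Quotient.mk z : ChainClass φ) - Q (twistedBoundary φ 0 z) ∈
      loopClasses φ := htop.ge (AddSubgroup.mem_top z)
  rw [LinearMap.mem_ker.1 hz, map_zero, sub_zero] at hz'
  obtain ⟨g, hg, e⟩ := hz'
  obtain ⟨P, rfl⟩ := Path.Homotopic.Quotient.mk_surjective g
  exact ⟨P, hg, (Submodule.Quotient.eq _).1 e⟩

/-- The vertices of a lifted simplex. -/
def vertexAt {n : ℕ} (s : LiftedSimplex Y y₀ n) (a : Fin (n + 1)) : LiftedSimplex Y y₀ 0 :=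
  ⟨ContinuousMap.const _ (s.simplex (stdSimplex.vertex a)),
    s.lift.trans (.map (.mk (edge 0 a)) s.simplex)⟩

lemma ext_zero {v w : LiftedSimplex Y y₀ 0}
    (h : v.simplex (stdSimplex.vertex 0) = w.simplex (stdSimplex.vertex 0))
    (h' : v.lift ≍ w.lift) : v = w := by
  refine ext_heq ?_ h'
  ext x
  rw [Subsingleton.elim x (stdSimplex.vertex 0), h]

lemma lift_face_zero_heq {n : ℕ} (s : LiftedSimplex Y y₀ (n + 1)) :
    (face 0 s).lift ≍ s.lift.trans (.map (.mk (edge 0 (Fin.succAbove 0 0))) s.simplex) :=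
  Quotient.cast_heq _ _

/-- Two successive edges are homotopic to the direct one since the simplex is contractible. Thus a
vertex has the same lift from whichever face it is reached, as the telescoping over the faces of a
triangle requires. -/
lemma face_zero_face (s : LiftedSimplex Y y₀ 2) (i : Fin 3) :
    face 0 (face i s) = vertexAt s (i.succAbove 1) := by
  refine ext_zero ?_ ?_
  · exact congrArg s.simplex ((congrArg _ (faceInclusion_vertex 0 0)).trans
      (faceInclusion_vertex i 1))
  · refine (lift_face_zero_heq _).trans ?_
    refine HEq.trans (b := (s.lift.trans (.map (.mk (edge 0 (i.succAbove 0))) s.simplex)).trans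
      (.map (.mk (edge (i.succAbove 0) (i.succAbove 1))) s.simplex))
      (trans_heq ?_ ?_ (Quotient.cast_heq _ _) ?_) (heq_of_eq ?_)
    · exact congrArg s.simplex (faceInclusion_vertex i 0)
    · exact congrArg s.simplex (faceInclusion_vertex i 1)
    · exact Path.Homotopic.hpath_hext fun t => congrArg s.simplex (faceInclusion_edge i 0 1 t)
    · rw [Quotient.trans_assoc, ← map_trans, edge_homotopic]
      rfl

lemma face_one_face (s : LiftedSimplex Y y₀ 2) (i : Fin 3) :
    face 1 (face i s) = vertexAt s (i.succAbove 0) := by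
  refine ext_zero ?_ ?_
  · exact congrArg s.simplex ((congrArg _ (faceInclusion_vertex 1 0)).trans
      (faceInclusion_vertex i 0))
  · exact (lift_face_heq 1 rfl _).trans (Quotient.cast_heq _ _)

/-- The base point of the universal cover. -/
def coverBase (y₀ : Y) : LiftedSimplex Y y₀ 0 :=
  ⟨ContinuousMap.const _ y₀, .refl y₀⟩

lemma ofPath_lift_heq {a b : Y} (γ : Path.Homotopic.Quotient y₀ a) (P : Path a b) :
    (ofPath γ P).lift ≍ γ :=
  Quotient.cast_heq _ _

lemma face_one_loop (P : Path y₀ y₀) : face 1 (ofPath (.refl y₀) P) = coverBase y₀ := by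
  refine ext_zero ?_ ((lift_face_heq 1 rfl _).trans (ofPath_lift_heq _ _))
  refine (congrArg (ofPath (.refl y₀) P).simplex ((faceInclusion_vertex 1 0).trans
    (edge 0 1).source.symm)).trans ?_
  exact (congrArg P (simplexParam_edge 0)).trans P.source

lemma face_zero_loop (P : Path y₀ y₀) :
    face 0 (ofPath (.refl y₀) P) = deck (FundamentalGroup.fromPath (.mk P)) (coverBase y₀) := by
  refine ext_zero ?_ ?_
  · refine (congrArg (ofPath (.refl y₀) P).simplex ((faceInclusion_vertex 0 0).trans
      (edge 0 1).target.symm)).trans ?_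
    exact (congrArg P (simplexParam_edge 1)).trans P.target
  · refine (lift_face_zero_heq _).trans ?_
    refine HEq.trans (b := (Path.Homotopic.Quotient.refl y₀).trans (.mk P)) ?_ (heq_of_eq ?_)
    · refine trans_heq ?_ ?_ (ofPath_lift_heq _ _) ?_
      · exact (congrArg P ((congrArg simplexParam (edge (0 : Fin 2) 1).source.symm).trans
          (simplexParam_edge 0))).trans P.source
      · exact (congrArg P ((congrArg simplexParam (edge (0 : Fin 2) 1).target.symm).trans
          (simplexParam_edge 1))).trans P.target
      · exact Path.Homotopic.hpath_hext (p₁ := (edge 0 1).map (ofPath (.refl y₀) P).simplex.continuous)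
          (p₂ := P) fun t => congrArg P (simplexParam_edge t)
    · exact (Path.Homotopic.Quotient.refl_trans _).trans
        (Path.Homotopic.Quotient.trans_refl _).symm

/-- A loop in the kernel of the coefficient system is a cycle. -/
lemma chain_loop_mem_twistedCycles {P : Path y₀ y₀}
    (hP : FundamentalGroup.fromPath (.mk P) ∈ φ.ker) :
    chain φ (ofPath (.refl y₀) P) ∈ twistedCycles φ := by
  rw [LinearMap.mem_ker, twistedBoundary_chain, Fin.sum_univ_two]
  rw [face_zero_loop, face_one_loop, chain_deck, MonoidHom.mem_ker.1 hP, map_one]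
  simp

/-- Injectivity in the Hurewicz theorem. -/
theorem mem_commutator_of_chain_mem_range (hφ : Function.Surjective φ) {P : Path y₀ y₀}
    (hP : FundamentalGroup.fromPath (.mk P) ∈ φ.ker)
    (h : chain φ (ofPath (.refl y₀) P) ∈ LinearMap.range (twistedBoundary φ 1)) :
    (⟨FundamentalGroup.fromPath (.mk P), hP⟩ : φ.ker) ∈ commutator φ.ker := by
  -- `c` is not invariant under the kernel, but an element of it shifts both ends of an edge
  -- equally. So the coboundary of `c` descends to twisted chains; it kills boundaries and sends a
  -- loop in the kernel to its class in the abelianisation.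
  let c : LiftedSimplex Y y₀ 0 → Additive (Abelianization φ.ker) := fun v =>
    .ofMul (.of (orbitDiff φ v))
  have hc : ∀ (g : φ.ker) v, c (deck g v) = c v + .ofMul (.of g) := by
    intro g v
    simp only [c, orbitDiff_deck, map_mul, ofMul_mul]
  obtain ⟨Θ, hΘ⟩ := exists_chain_extension hφ (fun s => c (face 0 s) - c (face 1 s))
    (fun g hg s => by
      simp only [face_deck]
      rw [hc ⟨g, hg⟩, hc ⟨g, hg⟩, add_sub_add_right_eq_sub])
  have hb : ∀ z, Θ (twistedBoundary φ 1 z) = 0 := by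
    intro z
    have htop := addSubgroup_eq_top_of_chain hφ
      (Θ.comp (twistedBoundary φ 1).toAddMonoidHom).ker (fun s => by
        change Θ (twistedBoundary φ 1 (chain φ s)) = 0
        rw [twistedBoundary_chain, Fin.sum_univ_three]
        simp only [map_add, map_zsmul, hΘ, face_zero_face, face_one_face]
        have h1 : Fin.succAbove (0 : Fin 3) (1 : Fin 2) = 2 := rfl
        have h2 : Fin.succAbove (0 : Fin 3) (0 : Fin 2) = 1 := rfl
        have h3 : Fin.succAbove (1 : Fin 3) (1 : Fin 2) = 2 := rfl
        have h4 : Fin.succAbove (1 : Fin 3) (0 : Fin 2) = 0 := rfl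
        have h5 : Fin.succAbove (2 : Fin 3) (1 : Fin 2) = 1 := rfl
        have h6 : Fin.succAbove (2 : Fin 3) (0 : Fin 2) = 0 := rfl
        rw [h1, h2, h3, h4, h5, h6]
        simp)
    exact htop.ge (AddSubgroup.mem_top z)
  obtain ⟨b, hb'⟩ := h
  have h0 := hb b
  rw [hb', hΘ, face_zero_loop, face_one_loop, hc ⟨_, hP⟩, add_sub_cancel_left] at h0
  exact (QuotientGroup.eq_one_iff _).1 h0

end Hurewicz

/-! ### Kernels of maps of Alexander modules -/

section AlexanderKernel

open LiftedSimplex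

variable {Y Z : Type*} [TopologicalSpace Y] [TopologicalSpace Z] {y₀ : Y}

/-- The class in the Alexander module of a loop that is trivial in the abelianisation. -/
def loopHomology (P : Path y₀ y₀)
    (hP : FundamentalGroup.fromPath (.mk P) ∈ commutator (FundamentalGroup Y y₀)) :
    AlexanderModule Y y₀ :=
  Submodule.Quotient.mk ⟨chain _ (ofPath (.refl y₀) P), chain_loop_mem_twistedCycles (by
    rwa [Abelianization.ker_of])⟩

lemma exists_eq_loopHomology (x : AlexanderModule Y y₀) :
    ∃ P hP, x = loopHomology (y₀ := y₀) P hP := by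
  obtain ⟨z, rfl⟩ := Submodule.Quotient.mk_surjective _ x
  obtain ⟨P, hP, h⟩ := exists_loop_of_mem_twistedCycles (QuotientGroup.mk'_surjective _) z.2
  rw [Abelianization.ker_of] at hP
  exact ⟨P, hP, (Submodule.Quotient.eq _).2 h⟩

/-- If `π₁(Z)` is metabelian, a loop representing a class of the Alexander module of `Y` maps to zero
in the Alexander module of `Z` precisely when it maps to the trivial element of `π₁(Z)`. -/
theorem alexanderMap_loopHomology_eq_zero_iff (f : C(Y, Z))
    (hZ : ∀ a ∈ commutator (FundamentalGroup Z (f y₀)),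
      ∀ b ∈ commutator (FundamentalGroup Z (f y₀)), a * b = b * a) (P : Path y₀ y₀)
    (hP : FundamentalGroup.fromPath (.mk P) ∈ commutator (FundamentalGroup Y y₀)) :
    alexanderMap f y₀ (loopHomology P hP) = 0 ↔
      FundamentalGroup.map f y₀ (FundamentalGroup.fromPath (.mk P)) = 1 := by
  let ψ := Abelianization.of (G := FundamentalGroup Z (f y₀))
  have h₁ : alexanderMap f y₀ (loopHomology P hP) = 0 ↔
      chain ψ (ofPath (.refl (f y₀)) (P.map f.continuous)) ∈
        LinearMap.range (twistedBoundary ψ 1) := by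
    have := twistedChainMap_chain f (φ := Abelianization.of) (ψ := ψ)
      (Abelianization.map (FundamentalGroup.map f y₀)) rfl (ofPath (.refl y₀) P)
    rw [push_ofPath] at this
    refine (Submodule.Quotient.mk_eq_zero _).trans ?_
    exact Eq.to_iff (congrArg (· ∈ LinearMap.range (twistedBoundary ψ 1)) this)
  rw [h₁]
  change _ ↔ FundamentalGroup.fromPath (.mk (P.map f.continuous)) = 1
  constructor
  · intro h
    have hker : FundamentalGroup.fromPath (.mk (P.map f.continuous)) ∈ ψ.ker := by
      have h := Abelianization.map_of (FundamentalGroup.map f y₀)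
        (FundamentalGroup.fromPath (.mk P))
      have hP' := hP
      rw [← Abelianization.ker_of, MonoidHom.mem_ker] at hP'
      rw [hP', map_one] at h
      exact h.symm
    have hmem := mem_commutator_of_chain_mem_range (QuotientGroup.mk'_surjective _) hker h
    -- The kernel of `ψ` is the commutator subgroup of `π₁(Z)`, which is abelian by `hZ`.
    have hbot : commutator ψ.ker ≤ ⊥ := by
      refine Subgroup.commutator_le.2 fun a _ b _ => ?_
      rw [Subgroup.mem_bot, commutatorElement_eq_one_iff_mul_comm]
      exact Subtype.ext (hZ _ ((Abelianization.ker_of _).le a.2) _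
        ((Abelianization.ker_of _).le b.2))
    exact congrArg Subtype.val (Subgroup.mem_bot.1 (hbot hmem))
  · intro h
    refine (Submodule.Quotient.mk_eq_zero _).1 ((pathClass_mk ψ _).symm.trans ?_)
    exact (congrArg (fun γ : FundamentalGroup Z (f y₀) => pathClass ψ γ.toPath) h).trans
      (pathClass_refl ψ)

end AlexanderKernel

/-! ### Group theory -/

lemma doublingAction_generator (x : Localization.Away (2 : ℤ)) :
    doublingAction (Multiplicative.ofAdd 1) (Multiplicative.ofAdd x) =
      Multiplicative.ofAdd (2 * x) := by
  simp [doublingAction]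

lemma doublingAction_generator_pow (n : ℕ) (x : Localization.Away (2 : ℤ)) :
    doublingAction (Multiplicative.ofAdd 1 ^ n) (Multiplicative.ofAdd x) =
      Multiplicative.ofAdd (2 ^ n * x) := by
  induction n generalizing x with
  | zero => simp
  | succ n ih =>
    rw [pow_succ, map_mul, MulAut.mul_apply, doublingAction_generator, ih, pow_succ, mul_assoc]

lemma eq_zero_of_two_pow_eq_one {n : ℕ} (h : (2 : Localization.Away (2 : ℤ)) ^ n = 1) :
    n = 0 := by
  have hinj : Function.Injective (algebraMap ℤ (Localization.Away (2 : ℤ))) :=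
    IsLocalization.injective _ (powers_le_nonZeroDivisors_of_noZeroDivisors two_ne_zero)
  have h2 : algebraMap ℤ (Localization.Away (2 : ℤ)) (2 ^ n) = algebraMap ℤ _ 1 := by
    simpa using h
  by_contra hn
  exact absurd (hinj h2) (one_lt_pow₀ one_lt_two hn).ne'

/-- The doubling action is faithful, as seen on the element `1`. -/
lemma eq_one_of_doublingAction_one (m : Multiplicative ℤ)
    (h : doublingAction m (Multiplicative.ofAdd 1) = Multiplicative.ofAdd 1) : m = 1 := by
  have key : ∀ n : ℕ, doublingAction (Multiplicative.ofAdd 1 ^ n) (Multiplicative.ofAdd 1) =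
      Multiplicative.ofAdd 1 → n = 0 := by
    intro n hn
    rw [doublingAction_generator_pow, mul_one] at hn
    exact eq_zero_of_two_pow_eq_one (Multiplicative.ofAdd.injective hn)
  obtain ⟨n, hn | hn⟩ := Int.eq_nat_or_neg m.toAdd
  · have hm : m = Multiplicative.ofAdd 1 ^ n := by
      rw [← ofAdd_nsmul, nsmul_one, ← ofAdd_toAdd m, hn]
    rw [hm] at h ⊢
    rw [key n h, pow_zero]
  · have hm : m = (Multiplicative.ofAdd 1 ^ n)⁻¹ := by
      rw [← ofAdd_nsmul, nsmul_one, ← ofAdd_toAdd m, hn]; rfl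
    rw [hm] at h ⊢
    have h' := congrArg (doublingAction (Multiplicative.ofAdd 1 ^ n)) h
    rw [map_inv, MulAut.apply_inv_self] at h'
    rw [key n h'.symm, pow_zero, inv_one]

/-- The Baumslag–Solitar group has trivial centre. -/
lemma BaumslagSolitar.eq_one_of_central (x : BaumslagSolitar) (h : ∀ y, y * x = x * y) :
    x = 1 := by
  -- Commuting with `1 ∈ ℤ[1/2]` forces `x.right` to act trivially on `1`.
  have hr : x.right = 1 := by
    refine eq_one_of_doublingAction_one _ ?_
    have := congrArg SemidirectProduct.left (h (SemidirectProduct.inl (Multiplicative.ofAdd 1)))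
    simp [mul_comm] at this
    exact this.symm
  -- Commuting with the generator of `ℤ` gives `2 * l = l` for the `ℤ[1/2]` component `l`.
  have hl : x.left = 1 := by
    have := congrArg SemidirectProduct.left (h (SemidirectProduct.inr (Multiplicative.ofAdd 1)))
    have h2 := doublingAction_generator (Multiplicative.toAdd x.left)
    simp at this
    rw [ofAdd_toAdd, this] at h2
    have h3 := congrArg Multiplicative.toAdd h2
    rw [toAdd_ofAdd, two_mul, left_eq_add] at h3
    exact h3
  exact SemidirectProduct.ext hl hr

/-- The normal subgroup `ℤ[1/2]` of the Baumslag–Solitar group is abelian. -/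
lemma BaumslagSolitar.commute_of_right {x y : BaumslagSolitar} (hx : x.right = 1)
    (hy : y.right = 1) : x * y = y * x := by
  refine SemidirectProduct.ext ?_ ?_
  · simp [hx, hy, mul_comm]
  · simp [hx, hy]

section Transport

variable {Γ : Type*} [Group Γ]

lemma eq_one_of_central_of_mulEquiv (e : Γ ≃* BaumslagSolitar) (x : Γ) (h : ∀ y, y * x = x * y) : x = 1 := by
  refine e.injective ((BaumslagSolitar.eq_one_of_central _ fun y => ?_).trans (map_one e).symm)
  have := congrArg e (h (e.symm y))
  simpa using this

/-- Commutators die in the abelian quotient `ℤ`, so they land in the abelian subgroup `ℤ[1/2]`. -/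
lemma commute_of_mem_commutator_of_mulEquiv (e : Γ ≃* BaumslagSolitar) (a : Γ)
    (ha : a ∈ commutator Γ) (b : Γ) (hb : b ∈ commutator Γ) : a * b = b * a := by
  have h : ∀ a ∈ commutator Γ, (e a).right = 1 := fun a ha =>
    Abelianization.commutator_subset_ker
      ((SemidirectProduct.rightHom (φ := doublingAction)).comp e.toMonoidHom) ha
  refine e.injective ?_
  rw [map_mul, map_mul]
  exact BaumslagSolitar.commute_of_right (h a ha) (h b hb)

end Transport

open scoped commutatorElement in
/-- The kernel of a surjection to a centreless group is controlled by its intersection with the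
commutator subgroup. -/
lemma ker_le_ker_of_commutator {Γ G H : Type*} [Group Γ] [Group G] [Group H] (p : Γ →* G)
    (q : Γ →* H) (hq : Function.Surjective q) (hH : ∀ x : H, (∀ y, y * x = x * y) → x = 1)
    (h : ∀ g ∈ commutator Γ, p g = 1 → q g = 1) : p.ker ≤ q.ker := by
  intro x hx
  refine hH _ fun y => ?_
  obtain ⟨y, rfl⟩ := hq y
  have := h ⁅y, x⁆ (Subgroup.commutator_mem_commutator (Subgroup.mem_top _) (Subgroup.mem_top _))
    (by rw [map_commutatorElement, MonoidHom.mem_ker.1 hx, commutatorElement_one_right])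
  rwa [map_commutatorElement, commutatorElement_eq_one_iff_mul_comm] at this

/-! ### Lagrangians -/

namespace DiscTube

variable {K : Knot} {κ : Tube K} {D D₁ D₂ : SliceDisc K}

/-- The inclusion of `X_K` in `N_D` factors through `M_K`. -/
lemma surjective_pi1Map (δ : DiscTube κ D) (h : δ.IsHomotopyRibbon) :
    Function.Surjective δ.pi1Map := by
  intro x
  obtain ⟨g, hg⟩ := h x
  let j : C(κ.Exterior, κ.Surgery) := ⟨fun p => Quot.mk _ (.inl p),
    continuous_quot_mk.comp continuous_inl⟩
  refine ⟨FundamentalGroup.map j κ.base g, Eq.trans ?_ hg⟩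
  exact (Path.Homotopic.Quotient.map_comp (p := g.toPath) (f := j)
    (g := δ.surgeryInclusion)).symm

/-- Every class of the Alexander module of `M_K` is represented by a loop in the commutator
subgroup, and membership in either lagrangian is tested on that same loop. -/
lemma lagrangian_le_iff (δ₁ : DiscTube κ D₁) (δ₂ : DiscTube κ D₂)
    (h₁ : Nonempty (δ₁.Pi1 ≃* BaumslagSolitar)) (h₂ : Nonempty (δ₂.Pi1 ≃* BaumslagSolitar)) :
    δ₁.lagrangian ≤ δ₂.lagrangian ↔
      ∀ g ∈ commutator (FundamentalGroup κ.Surgery κ.surgeryBase),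
        δ₁.pi1Map g = 1 → δ₂.pi1Map g = 1 := by
  obtain ⟨e₁⟩ := h₁
  obtain ⟨e₂⟩ := h₂
  have k₁ := alexanderMap_loopHomology_eq_zero_iff δ₁.surgeryInclusion
    (commute_of_mem_commutator_of_mulEquiv e₁)
  have k₂ := alexanderMap_loopHomology_eq_zero_iff δ₂.surgeryInclusion
    (commute_of_mem_commutator_of_mulEquiv e₂)
  constructor
  · intro h g hg hg₁
    obtain ⟨P, rfl⟩ := Path.Homotopic.Quotient.mk_surjective g
    exact (k₂ P hg).1 (h ((k₁ P hg).2 hg₁))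
  · intro h x hx
    obtain ⟨P, hP, rfl⟩ := exists_eq_loopHomology x
    exact (k₂ P hP).2 (h _ hP ((k₁ P hP).1 hx))

end DiscTube

end HomotopyRibbon

end

/-! ### Equal lagrangians and compatibility -/

theorem proposition3p3 (K : HomotopyRibbon.Knot) (κ : HomotopyRibbon.Tube K)
    (hκ : κ.IsZeroFramed) (D₁ D₂ : HomotopyRibbon.SliceDisc K)
    (δ₁ : HomotopyRibbon.DiscTube κ D₁) (δ₂ : HomotopyRibbon.DiscTube κ D₂)
    (h₁ : δ₁.IsGroupHomotopyRibbon HomotopyRibbon.BaumslagSolitar)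
    (h₂ : δ₂.IsGroupHomotopyRibbon HomotopyRibbon.BaumslagSolitar) :
    δ₁.lagrangian = δ₂.lagrangian ↔ HomotopyRibbon.DiscTube.Compatible δ₁ δ₂ := by
  have s₁ := δ₁.surjective_pi1Map h₁.1
  have s₂ := δ₂.surjective_pi1Map h₂.1
  rw [le_antisymm_iff, δ₁.lagrangian_le_iff δ₂ h₁.2 h₂.2, δ₂.lagrangian_le_iff δ₁ h₂.2 h₁.2]
  constructor
  · rintro ⟨h, h'⟩
    obtain ⟨e₁⟩ := h₁.2
    obtain ⟨e₂⟩ := h₂.2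
    have hker : δ₁.pi1Map.ker = δ₂.pi1Map.ker := le_antisymm
      (HomotopyRibbon.ker_le_ker_of_commutator _ _ s₂
        (HomotopyRibbon.eq_one_of_central_of_mulEquiv e₂) h)
      (HomotopyRibbon.ker_le_ker_of_commutator _ _ s₁
        (HomotopyRibbon.eq_one_of_central_of_mulEquiv e₁) h')
    -- Both groups are the quotient of `π₁(M_K)` by the common kernel, and the isomorphism through
    -- it respects the maps from `π₁(M_K)`.
    refine ⟨(QuotientGroup.quotientKerEquivOfSurjective _ s₁).symm.trans
      ((QuotientGroup.quotientMulEquivOfEq hker).trans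
        (QuotientGroup.quotientKerEquivOfSurjective _ s₂)), ?_⟩
    ext g
    have hg : (QuotientGroup.quotientKerEquivOfSurjective _ s₁).symm (δ₁.pi1Map g) =
        QuotientGroup.mk g := (MulEquiv.symm_apply_eq _).2 rfl
    change (QuotientGroup.quotientKerEquivOfSurjective _ s₂) (QuotientGroup.quotientMulEquivOfEq hker
      ((QuotientGroup.quotientKerEquivOfSurjective _ s₁).symm (δ₁.pi1Map g))) = _
    rw [hg]
    rfl
  · rintro ⟨f, hf⟩
    have h : ∀ g, δ₁.pi1Map g = 1 ↔ δ₂.pi1Map g = 1 := fun g => by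
      rw [← hf]
      exact (map_eq_one_iff f f.injective).symm
    exact ⟨fun g _ => (h g).1, fun g _ => (h g).2⟩
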